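/- **Setting.** Let $M$ be a finite simplicial or cubical complex in a Euclidean space (a finite set of simplices, respectively hypercubes, closed under taking faces, any two of which are disjoint or meet in a common face), with a fixed linear ordering of the vertices; in the cubical case assume that the minimal and the maximal vertex of each $2$-dimensional face are opposite. Denote by $C^k(M;X)=C_k(M;X)$ the set of functions on the $k$-dimensional faces with values in $X$. A positive basis of a face consists of the vectors going from its minimal vertex along its edges, ordered by their endpoints. Let $\delta$ and $\partial$ be the coboundary and the boundary, with incidence number $+1$ (respectively, $-1$) if an outer normal followed by a positive basis of the hyperface is a positive (respectively, negative) basis of the face. A splitting $(g,h)$ of a face $f$ is a pair of faces $g,h\subset f$ with $\min g=\min f$, $\max g=\min h$, $\max h=\max f$, $\dim g+\dim h=\dim f$; let $\langle g,h\rangle_f=\pm1$ be the orientation of the positive basis of $g$ followed by that of $h$ relative to the positive basis of $f$. For matrix-valued $\Phi\in C^k$, $\Psi\in C^l$ put $$[\Phi\smile\Psi](f)=\sum_{(g,h)}\langle g,h\rangle_f\,\Phi(g)\Psi(h),\qquad [\Phi\frown\Psi](h)=\sum_{(f,g)}\langle g,h\rangle_f\,\Phi(f)\Psi(g),\qquad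 [\Phi\stackrel{*}{\frown}\Psi](g)=\sum_{(f,h)}\langle g,h\rangle_f\,\Phi(h)\Psi(f),$$ where the sums are over splittings $(g,h)$ of $f$ with factors of the appropriate dimensions. Let $*$ be the (facewise) conjugate transpose. Let $G$ be a Lie group with a smooth unitary representation on $\mathbb C^n$; elements of $G$ are identified with their matrices. Let $T_uG\subset\mathbb C^{n\times n}$ be the linear subspace parallel to the tangent space to $G$ at $u$ (the image of the differential of the representation), and $\mathrm{Pr}_{T_uG}$ the orthogonal projection with respect to $\langle u,v\rangle=\mathrm{Re}\,\mathrm{Tr}[u^*v]$. For $U\in C^1(M;\mathbb C^{n\times n})$ put $A=A[U]=U-1$. For $\phi\in C^k(M;\mathbb C^{p\times n})$ put $D_A\phi=\delta\phi-(-1)^k\phi\smile A$; for $j\in C_1(M;\mathbb C^{n\times n})$ put $D_A^*j=\partial j+(j^*\frown A)^*-(A\stackrel{*}{\frown}j^*)^*$, and let $\mathrm{Pr}_{T_UG}\,j$ be the edgewise projection $[\mathrm{Pr}_{T_UG}\,j](e)=\mathrm{Pr}_{T_{U(e)}G}\,j(e)$. The covariant current $j$ is *conserved* (for $U\in C^1(M;G)$)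 if $D_A^*\,\mathrm{Pr}_{T_UG}\,j=0$. A *local Lagrangian* is a differentiable map $\mathcal L\colon C^k(M;\mathbb C^{p\times n})\times C^1(M;\mathbb C^{n\times n})\to C_0(M;\mathbb R)$ such that, for each vertex $v$, $\mathcal L[\phi,U](v)=L_v\big((\phi(f))_{f},([D_{A[U]}\phi](f'))_{f'}\big)$ for some differentiable function $L_v$ not depending on $U$, where $f$ and $f'$ run over the faces of dimension $k$ and $k+1$, respectively, with maximal vertex $v$. For a real function $\mathrm f$ of a complex matrix $z$ let $(\partial \mathrm f/\partial z)_{ba}=\partial \mathrm f/\partial(\mathrm{Re}\,z_{ab})-i\,\partial \mathrm f/\partial(\mathrm{Im}\,z_{ab})$. Let $\frac{\partial\mathcal L}{\partial(D_A\phi)}\in C_{k+1}(M;\mathbb C^{n\times p})$ take on a face $f'$ the value of the derivative of $L_{\max f'}$ with respect to the argument $[D_A\phi](f')$, and let $\frac{\partial\mathcal L}{\partial U}\in C_1(M;\mathbb C^{n\times n})$ take on an edge $e$ the value of the derivative of $\mathcal L[\phi,U](\max e)$ with respect to $U(e)$. The field $\phi$ is *on shell* for fixed $U$ if it is stationary for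 $\phi\mapsto\sum_v\mathcal L[\phi,U](v)$. The Lagrangian is *gauge invariant* if $\mathcal L[\phi\smile g,\,g^*\smile U\smile g]=\mathcal L[\phi,U]$ for all $\phi\in C^k(M;\mathbb C^{p\times n})$, $U\in C^1(M;G)$, $g\in C^0(M;G)$, where $[\phi\smile g](f)=\phi(f)g(\max f)$ and $[g^*\smile U\smile g](e)=g(\min e)^*U(e)g(\max e)$. **Theorem (Charge conservation).** If a local Lagrangian $\mathcal L[\phi,U]$ is gauge invariant, then for each gauge group field $U\in C^1(M;G)$ and each field $\phi\in C^k(M;\mathbb C^{p\times n})$ on shell for this $U$ the covariant current $$j[\phi,U]=\left(\frac{\partial\mathcal L[\phi,U]}{\partial(D_A\phi)}\frown\phi\right)^*=(-1)^{k+1}\left(\frac{\partial\mathcal L[\phi,U]}{\partial U}\right)^*$$ is conserved: $D_A^*\,\mathrm{Pr}_{T_UG}\,j[\phi,U]=0$. Equivalently, $(\partial\mathcal L[\phi,U]/\partial U)^*$ is conserved. -/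

import Mathlib

open scoped Matrix ContDiff Manifold

noncomputable section

namespace LatticeGauge

/-! ### Finite simplicial and cubical complexes with ordered vertices

The vertices are labelled by a finite linearly ordered type `V`; `pos` places them in a Euclidean
space. Simplices and hypercubes are recorded by their sets of vertices. -/

section Complexes

variable {V : Type*} {d : ℕ}

/-- `s` is the vertex set of a (nondegenerate, nonempty) simplex. -/
def IsSimplex (pos : V → EuclideanSpace ℝ (Fin d)) (s : Finset V) : Prop :=
  s.Nonempty ∧ AffineIndependent ℝ (fun x : s => pos x)

/-- `s` is the vertex set of a hypercube: there are pairwise orthogonal vectors `e i` of a common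
length `r > 0` such that the vertices are the points `o + ∑ i ∈ S, e i`. -/
def IsHypercube (pos : V → EuclideanSpace ℝ (Fin d)) (s : Finset V) : Prop :=
  ∃ (k : ℕ) (o : EuclideanSpace ℝ (Fin d)) (e : Fin k → EuclideanSpace ℝ (Fin d)) (r : ℝ),
    0 < r ∧ (∀ i j, inner ℝ (e i) (e j) = if i = j then r ^ 2 else 0) ∧
    pos '' (s : Set V) = Set.range (fun S : Finset (Fin k) => o + ∑ i ∈ S, e i)

/-- `t` is the vertex set of a (nonempty) face of the convex polytope with vertex set `s`: the set
of those vertices where some linear functional attains its maximum on `s`. -/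
def IsFaceOf (pos : V → EuclideanSpace ℝ (Fin d)) (t s : Finset V) : Prop :=
  t.Nonempty ∧ ∃ c : EuclideanSpace ℝ (Fin d),
    ∀ x, x ∈ t ↔ x ∈ s ∧ ∀ y ∈ s, inner ℝ c (pos y) ≤ inner ℝ c (pos x)

/-- The convex polytope with vertex set `s`. -/
def hull (pos : V → EuclideanSpace ℝ (Fin d)) (s : Finset V) : Set (EuclideanSpace ℝ (Fin d)) :=
  convexHull ℝ (pos '' (s : Set V))

/-- The linear subspace parallel to the affine span of `s`. -/
def dirSpan (pos : V → EuclideanSpace ℝ (Fin d)) (s : Finset V) :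
    Submodule ℝ (EuclideanSpace ℝ (Fin d)) :=
  vectorSpan ℝ (pos '' (s : Set V))

/-- The dimension of the polytope with vertex set `s`. -/
def polyDim (pos : V → EuclideanSpace ℝ (Fin d)) (s : Finset V) : ℕ :=
  Module.finrank ℝ (dirSpan pos s)

theorem polyDim_singleton (pos : V → EuclideanSpace ℝ (Fin d)) (v : V) :
    polyDim pos {v} = 0 := by
  have h : vectorSpan ℝ (pos '' ((({v} : Finset V)) : Set V)) = ⊥ := by simp
  unfold polyDim dirSpan
  rw [h]
  exact finrank_bot ℝ _

end Complexes

/-- A spacetime: a finite simplicial or cubical complex in a Euclidean space with a fixed vertex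
ordering; in the cubical case the minimal and the maximal vertex of each `2`-dimensional face are
opposite (that is, distinct and not joined by an edge). -/
structure Spacetime (V : Type*) [Fintype V] [LinearOrder V] (d : ℕ) where
  pos : V → EuclideanSpace ℝ (Fin d)
  pos_injective : Function.Injective pos
  faces : Finset (Finset V)
  singleton_mem : ∀ v, {v} ∈ faces
  nonempty_of_mem : ∀ s ∈ faces, s.Nonempty
  face_mem : ∀ s ∈ faces, ∀ t, IsFaceOf pos t s → t ∈ faces
  inter_eq : ∀ s ∈ faces, ∀ t ∈ faces, hull pos s ∩ hull pos t = ∅ ∨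
    ∃ u, IsFaceOf pos u s ∧ IsFaceOf pos u t ∧ hull pos s ∩ hull pos t = hull pos u
  shape : (∀ s ∈ faces, IsSimplex pos s) ∨
    ((∀ s ∈ faces, IsHypercube pos s) ∧
      ∀ s ∈ faces, polyDim pos s = 2 → ∀ a ∈ s, ∀ c ∈ s,
        (∀ x ∈ s, a ≤ x) → (∀ x ∈ s, x ≤ c) → a ≠ c ∧ {a, c} ∉ faces)

namespace Spacetime

variable {V : Type*} [Fintype V] [LinearOrder V] {d : ℕ} (M : Spacetime V d)

/-- The `k`-dimensional faces of `M`. -/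
abbrev Face (k : ℕ) : Type _ := {s : Finset V // s ∈ M.faces ∧ polyDim M.pos s = k}

/-- `k`-dimensional (co)chains with values in `X`; chains and cochains are not distinguished. -/
abbrev Cochain (k : ℕ) (X : Type*) : Type _ := M.Face k → X

/-- A vertex as a `0`-dimensional face. -/
def vtx (v : V) : M.Face 0 := ⟨{v}, M.singleton_mem v, polyDim_singleton M.pos v⟩

variable {M} {k l m : ℕ}

/-- The label of the minimal vertex of a face. -/
def minLabel (f : M.Face k) : V := f.1.min' (M.nonempty_of_mem f.1 f.2.1)

/-- The minimal vertex of a face. -/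
def minV (f : M.Face k) : M.Face 0 := M.vtx (minLabel f)

/-- The maximal vertex of a face. -/
def maxV (f : M.Face k) : M.Face 0 := M.vtx (f.1.max' (M.nonempty_of_mem f.1 f.2.1))

/-- The positively oriented basis of a face: the vectors going from the minimal vertex `a` along
the edges `{a, x}` of the face, ordered according to their endpoints `x`. -/
def posBasis (f : M.Face k) : List (EuclideanSpace ℝ (Fin d)) :=
  ((f.1.filter (fun x => x ≠ minLabel f ∧ {minLabel f, x} ∈ M.faces)).sort (· ≤ ·)).map
    (fun x => M.pos x - M.pos (minLabel f))

/-- `+1` (or `-1`) if the lists `u` and `w` are equally (or oppositely) oriented bases of the same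
`k`-dimensional subspace: the determinant of the matrix of scalar products is the determinant of
the transition matrix times the (positive) Gram determinant of `w`. -/
def relOrient (k : ℕ) (u w : List (EuclideanSpace ℝ (Fin d))) : ℤ :=
  ((SignType.sign (Matrix.det (Matrix.of fun i j : Fin k =>
    (inner ℝ (u.getD i 0) (w.getD j 0) : ℝ))) : SignType) : ℤ)

/-- `ν` is an outer normal to the hyperface `e` in the face `f`. -/
def IsOuterNormal (ν : EuclideanSpace ℝ (Fin d)) (e : M.Face k) (f : M.Face (k + 1)) : Prop :=
  ν ∈ dirSpan M.pos f.1 ∧ ν ≠ 0 ∧ (∀ w ∈ dirSpan M.pos e.1, inner ℝ ν w = 0) ∧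
    ∀ x ∈ f.1, ∀ y ∈ e.1, inner ℝ ν (M.pos x) ≤ inner ℝ ν (M.pos y)

open Classical in
/-- The incidence number of a face `f` and a face `e ⊂ ∂f` of dimension one less: `+1` if `e` and
`f` are cooriented (an outer normal followed by the positive basis of `e` is a positive basis of
`f`), `-1` if they are oppositely oriented, and `0` if `e` is not contained in `f`. -/
def incidence (e : M.Face k) (f : M.Face (k + 1)) : ℤ :=
  if e.1 ⊆ f.1 then
    if ∃ ν, IsOuterNormal ν e f ∧ relOrient (k + 1) (ν :: posBasis e) (posBasis f) = 1 then 1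
    else if ∃ ν, IsOuterNormal ν e f ∧ relOrient (k + 1) (ν :: posBasis e) (posBasis f) = -1
    then -1 else 0
  else 0

/-- `f = a…c`, `g = a…b`, `h = b…c` with `g, h ⊂ f` and `dim g + dim h = dim f`. In a simplicial
complex this means that `g` and `h` are spanned by the first and by the last vertices of `f`, with
exactly one common vertex. -/
def Splits (f : M.Face k) (g : M.Face l) (h : M.Face m) : Prop :=
  l + m = k ∧ g.1 ⊆ f.1 ∧ h.1 ⊆ f.1 ∧ minV g = minV f ∧ maxV g = minV h ∧ maxV h = maxV f

/-- The sign `⟨a, b, c⟩` for `f = a…c`, `g = a…b`, `h = b…c`. -/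
def tripleSign (f : M.Face k) (g : M.Face l) (h : M.Face m) : ℤ :=
  relOrient k (posBasis g ++ posBasis h) (posBasis f)

/-! ### Cochain operations -/

section Operations

variable {p q r n : ℕ}

/-- The coboundary `δ`. -/
def coboundary (Φ : M.Cochain k (Matrix (Fin p) (Fin q) ℂ)) :
    M.Cochain (k + 1) (Matrix (Fin p) (Fin q) ℂ) :=
  fun f => ∑ e, incidence e f • Φ e

/-- The boundary `∂`. -/
def boundary (Φ : M.Cochain (k + 1) (Matrix (Fin p) (Fin q) ℂ)) :
    M.Cochain k (Matrix (Fin p) (Fin q) ℂ) :=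
  fun e => ∑ f, incidence e f • Φ f

open Classical in
/-- The cup-product of a `k`-cochain and an `l`-cochain; it takes values on faces of dimension
`m = k + l`. (The equation is part of `Splits`; for other `m` the sum is empty.) -/
def cup (Φ : M.Cochain k (Matrix (Fin p) (Fin q) ℂ)) (Ψ : M.Cochain l (Matrix (Fin q) (Fin r) ℂ)) :
    M.Cochain m (Matrix (Fin p) (Fin r) ℂ) :=
  fun f => ∑ g, ∑ h, if Splits f g h then tripleSign f g h • (Φ g * Ψ h) else 0

open Classical in
/-- The cap-product of a `k`-chain and an `l`-cochain; it takes values on faces of dimension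
`m = k - l`. -/
def cap (Φ : M.Cochain k (Matrix (Fin p) (Fin q) ℂ)) (Ψ : M.Cochain l (Matrix (Fin q) (Fin r) ℂ)) :
    M.Cochain m (Matrix (Fin p) (Fin r) ℂ) :=
  fun h => ∑ f, ∑ g, if Splits f g h then tripleSign f g h • (Φ f * Ψ g) else 0

open Classical in
/-- The cop-product of a `k`-cochain and an `l`-chain; it takes values on faces of dimension
`m = l - k`. -/
def cop (Φ : M.Cochain k (Matrix (Fin p) (Fin q) ℂ)) (Ψ : M.Cochain l (Matrix (Fin q) (Fin r) ℂ)) :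
    M.Cochain m (Matrix (Fin p) (Fin r) ℂ) :=
  fun g => ∑ f, ∑ h, if Splits f g h then tripleSign f g h • (Φ h * Ψ f) else 0

/-- The facewise conjugate transpose `Φ^*`. -/
def adj (Φ : M.Cochain k (Matrix (Fin p) (Fin q) ℂ)) : M.Cochain k (Matrix (Fin q) (Fin p) ℂ) :=
  fun f => (Φ f)ᴴ

/-- The connection `A[U] = U - 1`. -/
def connection (U : M.Cochain 1 (Matrix (Fin n) (Fin n) ℂ)) :
    M.Cochain 1 (Matrix (Fin n) (Fin n) ℂ) :=
  fun e => U e - 1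

/-- The covariant coboundary `D_A φ = δφ - (-1)^k φ ⌣ A` of a matter field (whose values are
row vectors, or matrices on which the gauge group acts from the right only). -/
def covCoboundary (A : M.Cochain 1 (Matrix (Fin n) (Fin n) ℂ))
    (φ : M.Cochain k (Matrix (Fin p) (Fin n) ℂ)) :
    M.Cochain (k + 1) (Matrix (Fin p) (Fin n) ℂ) :=
  coboundary φ - (-1 : ℤ) ^ k • cup φ A

/-- The covariant boundary `D_A^* Φ = ∂Φ + (Φ^* ⌢ A)^* + (-1)^{k+1} (A ⌢^* Φ^*)^*` of a
`(k+1)`-chain with values in `n × n` matrices (on which the gauge group acts by conjugation). -/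
def covBoundary (A : M.Cochain 1 (Matrix (Fin n) (Fin n) ℂ))
    (Φ : M.Cochain (k + 1) (Matrix (Fin n) (Fin n) ℂ)) :
    M.Cochain k (Matrix (Fin n) (Fin n) ℂ) :=
  boundary Φ + adj (cap (adj Φ) A) + (-1 : ℤ) ^ (k + 1) • adj (cop A (adj Φ))

/-- The gauge transformation `φ ⌣ g` of a matter field by a `0`-cochain `g`:
`[φ ⌣ g](f) = φ(f) g(max f)`. -/
def gaugeMatter (φ : M.Cochain k (Matrix (Fin p) (Fin n) ℂ))
    (g : M.Cochain 0 (Matrix (Fin n) (Fin n) ℂ)) : M.Cochain k (Matrix (Fin p) (Fin n) ℂ) :=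
  fun f => φ f * g (maxV f)

/-- The gauge transformation `g^* ⌣ Φ ⌣ g`: `[g^* ⌣ Φ ⌣ g](f) = g(min f)^* Φ(f) g(max f)`. -/
def gaugeConj (Φ : M.Cochain k (Matrix (Fin n) (Fin n) ℂ))
    (g : M.Cochain 0 (Matrix (Fin n) (Fin n) ℂ)) : M.Cochain k (Matrix (Fin n) (Fin n) ℂ) :=
  fun f => (g (minV f))ᴴ * Φ f * g (maxV f)

end Operations

/-- The `k`-dimensional faces with maximal vertex `v`. -/
abbrev FaceAt (M : Spacetime V d) (k : ℕ) (v : M.Face 0) : Type _ := {f : M.Face k // maxV f = v}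

end Spacetime

open Spacetime

/-! ### Scalar product of matrices and gauge groups -/

section ScalarProduct

attribute [local instance] Matrix.frobeniusNormedAddCommGroup Matrix.frobeniusNormedSpace

/-- The scalar product `⟨u, v⟩ = Re Tr (u^* v)` of complex matrices. -/
@[reducible]
def matrixInner {p q : ℕ} : InnerProductSpace ℝ (Matrix (Fin p) (Fin q) ℂ) :=
  { Matrix.frobeniusNormedSpace with
    inner := fun u v => (Matrix.trace (uᴴ * v)).re
    norm_sq_eq_re_inner := by
      intro u
      have h : (Matrix.trace (uᴴ * u)).re = ∑ i, ∑ j, ‖u i j‖ ^ 2 := by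
        rw [Finset.sum_comm]
        simp [Matrix.trace, Matrix.mul_apply, Complex.sq_norm, Complex.normSq_apply]
      change ‖u‖ ^ 2 = (Matrix.trace (uᴴ * u)).re
      have h0 : 0 ≤ ∑ i, ∑ j, ‖u i j‖ ^ 2 := by positivity
      rw [h, Matrix.frobenius_norm_def, ← Real.sqrt_eq_rpow]
      simp only [Real.rpow_two]
      exact Real.sq_sqrt h0
    conj_inner_symm := by
      intro u v
      change (Matrix.trace (vᴴ * u)).re = (Matrix.trace (uᴴ * v)).re
      have h : vᴴ * u = (uᴴ * v)ᴴ := by simp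
      rw [h, Matrix.trace_conjTranspose]
      simp
    add_left := by
      intro u v w
      simp [Matrix.conjTranspose_add, Matrix.add_mul]
    smul_left := by
      intro u v c
      simp [Matrix.conjTranspose_smul] }

attribute [local instance] matrixInner

/-- The orthogonal projection of `u` to a real linear subspace `W` with respect to `Re Tr (u^* v)`. -/
def matProj {p q : ℕ} (W : Submodule ℝ (Matrix (Fin p) (Fin q) ℂ)) (u : Matrix (Fin p) (Fin q) ℂ) :
    Matrix (Fin p) (Fin q) ℂ :=
  haveI : FiniteDimensional ℝ W := inferInstance
  W.starProjection u

/-- `matProj W u` is the element `w` of `W` with `⟨y, u - w⟩ = 0` for all `y ∈ W`. -/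
theorem matProj_spec {p q : ℕ} (W : Submodule ℝ (Matrix (Fin p) (Fin q) ℂ))
    (u : Matrix (Fin p) (Fin q) ℂ) :
    matProj W u ∈ W ∧ ∀ y ∈ W, (Matrix.trace (yᴴ * (u - matProj W u))).re = 0 :=
  ⟨W.starProjection_apply_mem u, fun y hy =>
    (W.mem_orthogonal _).1 (W.sub_starProjection_mem_orthogonal u) y hy⟩

end ScalarProduct

/-- The matrix by which the element `x` of the gauge group acts. -/
def repMat {G : Type*} [Group G] {n : ℕ} (ρ : G →* Matrix.unitaryGroup (Fin n) ℂ) (x : G) :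
    Matrix (Fin n) (Fin n) ℂ :=
  (ρ x : Matrix (Fin n) (Fin n) ℂ)

section GaugeGroup

variable (E : Type*) [NormedAddCommGroup E] [NormedSpace ℝ E]
  {G : Type*} [Group G] [TopologicalSpace G] [ChartedSpace E G] {n : ℕ}

/-- The representation `ρ` is smooth (as a map to the space of arrays of complex numbers). -/
def IsSmoothRep (ρ : G →* Matrix.unitaryGroup (Fin n) ℂ) : Prop :=
  ContMDiff 𝓘(ℝ, E) 𝓘(ℝ, Fin n → Fin n → ℂ) ∞ (fun (x : G) i j => repMat ρ x i j)

/-- The tangent space `T_u G ⊂ ℂ^{n×n}` at (the matrix `u` of) the element `x` of `G`: the image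
of the differential at `x` of the representation. -/
def tangentMat (ρ : G →* Matrix.unitaryGroup (Fin n) ℂ) (x : G) :
    Submodule ℝ (Matrix (Fin n) (Fin n) ℂ) :=
  (LinearMap.range
    (mfderiv 𝓘(ℝ, E) 𝓘(ℝ, Fin n → Fin n → ℂ) (fun (x : G) i j => repMat ρ x i j) x :
      E →L[ℝ] (Fin n → Fin n → ℂ)).toLinearMap).map
    (Matrix.ofLinearEquiv ℝ : (Fin n → Fin n → ℂ) ≃ₗ[ℝ] Matrix (Fin n) (Fin n) ℂ).toLinearMap

variable {V : Type*} [Fintype V] [LinearOrder V] {d : ℕ} {M : Spacetime V d}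

/-- The edgewise orthogonal projection `Pr_{T_U G} j`. -/
def projTangent (ρ : G →* Matrix.unitaryGroup (Fin n) ℂ) (U : M.Cochain 1 G)
    (j : M.Cochain 1 (Matrix (Fin n) (Fin n) ℂ)) : M.Cochain 1 (Matrix (Fin n) (Fin n) ℂ) :=
  fun e => matProj (tangentMat E ρ (U e)) (j e)

end GaugeGroup

/-! ### Lagrangians -/

section Lagrangians

variable {V : Type*} [Fintype V] [LinearOrder V] {d : ℕ} {M : Spacetime V d} {k p n : ℕ}

/-- Lagrangians `𝓛[φ, U]`. -/
abbrev Lagrangian (M : Spacetime V d) (k p n : ℕ) : Type _ :=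
  M.Cochain k (Matrix (Fin p) (Fin n) ℂ) → M.Cochain 1 (Matrix (Fin n) (Fin n) ℂ) → M.Cochain 0 ℝ

/-- Families of functions `L_v(φ_1, …, φ'_1, …)`, where `φ_1, …` and `φ'_1, …` are indexed by the
`k`- and the `(k+1)`-dimensional faces with maximal vertex `v`. -/
abbrev LocalDensity (M : Spacetime V d) (k p n : ℕ) : Type _ :=
  (v : M.Face 0) → (M.FaceAt k v → Matrix (Fin p) (Fin n) ℂ) →
    (M.FaceAt (k + 1) v → Matrix (Fin p) (Fin n) ℂ) → ℝ

/-- `𝓛` is a local Lagrangian: it is differentiable, and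
`𝓛[φ, U](v) = L_v(φ(e_{v,k}), [D_{A[U]} φ](e_{v,k+1}))` with differentiable `L_v`. -/
def IsLocalLagrangian (𝓛 : Lagrangian M k p n) (L : LocalDensity M k p n) : Prop :=
  Differentiable ℝ (fun x : M.Cochain k (Matrix (Fin p) (Fin n) ℂ) ×
    M.Cochain 1 (Matrix (Fin n) (Fin n) ℂ) => 𝓛 x.1 x.2) ∧
  (∀ v, Differentiable ℝ (fun x : (M.FaceAt k v → Matrix (Fin p) (Fin n) ℂ) ×
    (M.FaceAt (k + 1) v → Matrix (Fin p) (Fin n) ℂ) => L v x.1 x.2)) ∧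
  ∀ φ U v, 𝓛 φ U v =
    L v (fun f => φ f.1) (fun f => covCoboundary (connection U) φ f.1)

/-- The derivative `∂f/∂z` with `(∂f/∂z)_{lk} = ∂f/∂(Re z_{kl}) - i ∂f/∂(Im z_{kl})`. -/
def matDeriv {p q : ℕ} (f : Matrix (Fin p) (Fin q) ℂ → ℝ) (z : Matrix (Fin p) (Fin q) ℂ) :
    Matrix (Fin q) (Fin p) ℂ :=
  Matrix.of fun b a =>
    ((lineDeriv ℝ f z (Matrix.single a b 1) : ℝ) : ℂ) -
      Complex.I * ((lineDeriv ℝ f z (Matrix.single a b Complex.I) : ℝ) : ℂ)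

open Classical in
/-- The partial derivative `∂𝓛/∂(D_A φ)`, a `(k+1)`-chain: on a face `f` with maximal vertex `v` it
is the derivative of `L_v` with respect to the variable corresponding to `f`. -/
def derivCov (L : LocalDensity M k p n) (φ : M.Cochain k (Matrix (Fin p) (Fin n) ℂ))
    (U : M.Cochain 1 (Matrix (Fin n) (Fin n) ℂ)) :
    M.Cochain (k + 1) (Matrix (Fin n) (Fin p) ℂ) :=
  fun f => matDeriv
    (fun z => L (maxV f) (fun f' => φ f'.1)
      (Function.update (fun f' : M.FaceAt (k + 1) (maxV f) =>
        covCoboundary (connection U) φ f'.1) ⟨f, rfl⟩ z))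
    (covCoboundary (connection U) φ f)

open Classical in
/-- The partial derivative `∂𝓛/∂U`, a `1`-chain: on an edge `e` it is the derivative of
`𝓛[φ, U](max e)` with respect to the variable `U(e)`. -/
def derivU (𝓛 : Lagrangian M k p n) (φ : M.Cochain k (Matrix (Fin p) (Fin n) ℂ))
    (U : M.Cochain 1 (Matrix (Fin n) (Fin n) ℂ)) :
    M.Cochain 1 (Matrix (Fin n) (Fin n) ℂ) :=
  fun e => matDeriv (fun z => 𝓛 φ (Function.update U e z) (maxV e)) (U e)

/-- The action functional: the sum of the values of the Lagrangian over all the vertices. -/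
def action (𝓛 : Lagrangian M k p n) (φ : M.Cochain k (Matrix (Fin p) (Fin n) ℂ))
    (U : M.Cochain 1 (Matrix (Fin n) (Fin n) ℂ)) : ℝ :=
  ∑ v, 𝓛 φ U v

/-- `φ` is on shell: it is stationary for the action functional for the fixed `U`. -/
def IsOnShell (𝓛 : Lagrangian M k p n) (φ : M.Cochain k (Matrix (Fin p) (Fin n) ℂ))
    (U : M.Cochain 1 (Matrix (Fin n) (Fin n) ℂ)) : Prop :=
  ∀ Δ : M.Cochain k (Matrix (Fin p) (Fin n) ℂ),
    HasDerivAt (fun t : ℝ => action 𝓛 (φ + t • Δ) U) 0 0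

/-- Gauge invariance: `𝓛[φ ⌣ g, g^* ⌣ U ⌣ g] = 𝓛[φ, U]` for all `φ`, all gauge group fields `U`
and all `G`-valued functions `g` on vertices. -/
def IsGaugeInvariant {G : Type*} [Group G] (ρ : G →* Matrix.unitaryGroup (Fin n) ℂ)
    (𝓛 : Lagrangian M k p n) : Prop :=
  ∀ (φ : M.Cochain k (Matrix (Fin p) (Fin n) ℂ)) (U : M.Cochain 1 G) (g : M.Cochain 0 G),
    𝓛 (gaugeMatter φ (repMat ρ ∘ g)) (gaugeConj (repMat ρ ∘ U) (repMat ρ ∘ g)) =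
      𝓛 φ (repMat ρ ∘ U)

/-- The covariant current `j` is conserved: `D_A^* Pr_{T_U G} j = 0`. -/
def IsConserved (E : Type*) [NormedAddCommGroup E] [NormedSpace ℝ E]
    {G : Type*} [Group G] [TopologicalSpace G] [ChartedSpace E G]
    (ρ : G →* Matrix.unitaryGroup (Fin n) ℂ) (U : M.Cochain 1 G)
    (j : M.Cochain 1 (Matrix (Fin n) (Fin n) ℂ)) : Prop :=
  covBoundary (connection (repMat ρ ∘ U)) (projTangent E ρ U j) = 0

end Lagrangians

end LatticeGauge

end

/-! This is Noether's argument for gauge transformations supported at a single vertex `v`. Such a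
transformation preserves the action, so the variation of the action along each `X` in the Lie
algebra `T_1 G` vanishes. On shell the contribution of `φ` is zero, and what is left pairs `∂𝓛/∂U`
with the variation of `U` (`IsLocalLagrangian.sum_trace_derivU_gaugeVariation`). That variation is
`U(e) X` on edges ending at `v` and `Xᴴ U(e) = -X U(e)` on edges starting there. Locality enters
because `U(e)` affects the Lagrangian only at the vertex `max e`, so `∂𝓛/∂U` is also the derivative
of the whole action.

On the other side, the constant in `A = U - 1` cancels `∂`, and the covariant divergence of `J` at
`v` becomes the sum of `U(e)ᴴ J(e)` over incoming edges minus the sum of `J(e) U(e)ᴴ` over outgoing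
ones (`covBoundary_connection_apply`). For `J = Pr j` every summand lies in `T_1 G`, by translation
invariance of the tangent spaces. Hence the divergence `S` is itself an admissible `X`. Since `U X`
and `X U` are tangent, the projection drops out of the pairing, and the Noether identity reads `⟨S,
S⟩ = 0` (`IsSmoothRep.isConserved`).

The two formulas for the current agree by the chain rule, since cap is dual to cup
(`IsLocalLagrangian.derivU_eq`); this part needs locality only. -/

namespace LatticeGauge

/-! ### Vertex counts of simplices and hypercubes. -/

section Polytopes

variable {V : Type*} {d : ℕ}

theorem card_le_two_pow_of_isSimplex {pos : V → EuclideanSpace ℝ (Fin d)} {s : Finset V}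
    (hs : IsSimplex pos s) : s.card ≤ 2 ^ polyDim pos s := by
  obtain ⟨hne, hind⟩ := hs
  have hpos : 0 < s.card := hne.card_pos
  have hdim : polyDim pos s = s.card - 1 := by
    have h := hind.finrank_vectorSpan (n := s.card - 1) (by rw [Fintype.card_coe]; omega)
    have himage : Set.range (fun x : s => pos x) = pos '' (s : Set V) := by
      ext; simp
    rwa [himage] at h
  -- A simplex of dimension `m` has `m + 1 ≤ 2 ^ m` vertices.
  have := Nat.lt_two_pow_self (n := s.card - 1)
  rw [hdim]
  omega

theorem card_le_two_pow_of_isHypercube {pos : V → EuclideanSpace ℝ (Fin d)}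
    (hinj : Function.Injective pos) {s : Finset V} (hs : IsHypercube pos s) :
    s.card ≤ 2 ^ polyDim pos s := by
  obtain ⟨k, o, e, r, hr, horth, hrange⟩ := hs
  have hind : LinearIndependent ℝ e := by
    apply linearIndependent_of_ne_zero_of_inner_eq_zero
    · intro i hi
      have := horth i i
      rw [hi, inner_zero_left, if_pos rfl] at this
      exact (pow_pos hr 2).ne this
    · intro i j hij
      rw [horth, if_neg hij]
  -- The `k` independent vectors `e i` are differences of the vertices `o + e i` and `o`. The
  -- opposite inequality is not needed.
  have hk : k ≤ polyDim pos s := by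
    have hle : Submodule.span ℝ (Set.range e) ≤ dirSpan pos s := by
      rw [Submodule.span_le]
      rintro _ ⟨i, rfl⟩
      have h1 : o + ∑ j ∈ ({i} : Finset (Fin k)), e j ∈ pos '' (s : Set V) := by
        rw [hrange]; exact ⟨{i}, rfl⟩
      have h0 : o + ∑ j ∈ (∅ : Finset (Fin k)), e j ∈ pos '' (s : Set V) := by
        rw [hrange]; exact ⟨∅, rfl⟩
      have h := vsub_mem_vectorSpan ℝ h1 h0
      rwa [Finset.sum_singleton, Finset.sum_empty, add_zero, vsub_eq_sub, add_sub_cancel_left] at h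
    have := Submodule.finrank_mono hle
    rwa [finrank_span_eq_card hind, Fintype.card_fin] at this
  calc s.card = (pos '' (s : Set V)).ncard := by
        rw [Set.ncard_image_of_injective _ hinj, Set.ncard_coe_finset]
    _ ≤ (Set.univ : Set (Finset (Fin k))).ncard := by
        rw [hrange, ← Set.image_univ]
        exact Set.ncard_image_le
    _ = 2 ^ k := by simp [Set.ncard_univ]
    _ ≤ _ := Nat.pow_le_pow_right (by norm_num) hk

end Polytopes

/-! ### Edges and vertices: incidence, splittings, covariant divergence. -/

namespace Spacetime

variable {V : Type*} [Fintype V] [LinearOrder V] {d : ℕ} {M : Spacetime V d} {k : ℕ}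

/-- Faces are graded by the dimension of their span, not by the number of vertices. This bound,
crude but common to both shapes, suffices to identify `0`-faces with vertices and `1`-faces with
pairs of vertices. -/
theorem card_le_two_pow (f : M.Face k) : f.1.card ≤ 2 ^ k := by
  obtain ⟨s, hs, rfl⟩ := f
  rcases M.shape with h | ⟨h, -⟩
  · exact card_le_two_pow_of_isSimplex (h s hs)
  · exact card_le_two_pow_of_isHypercube M.pos_injective (h s hs)

theorem exists_eq_vtx (f : M.Face 0) : ∃ v, f = M.vtx v := by
  have hne := M.nonempty_of_mem f.1 f.2.1
  have hcard : f.1.card = 1 := le_antisymm (card_le_two_pow f) hne.card_pos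
  obtain ⟨v, hv⟩ := Finset.card_eq_one.1 hcard
  exact ⟨v, Subtype.ext hv⟩

theorem card_edge (f : M.Face 1) : f.1.card = 2 := by
  have hne := M.nonempty_of_mem f.1 f.2.1
  have h2 : f.1.card ≤ 2 := card_le_two_pow f
  have h1 : f.1.card ≠ 1 := by
    intro h
    obtain ⟨v, hv⟩ := Finset.card_eq_one.1 h
    have hdim := f.2.2
    rw [hv, polyDim_singleton] at hdim
    omega
  have := hne.card_pos
  omega

/-- The label of the maximal vertex of a face. -/
def maxLabel (f : M.Face k) : V := f.1.max' (M.nonempty_of_mem f.1 f.2.1)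

theorem maxV_eq (f : M.Face k) : maxV f = M.vtx (maxLabel f) := rfl

theorem minV_eq (f : M.Face k) : minV f = M.vtx (minLabel f) := rfl

theorem vtx_injective : Function.Injective M.vtx := fun _ _ h =>
  Finset.singleton_injective (congrArg Subtype.val h)

theorem minLabel_lt_maxLabel (f : M.Face 1) : minLabel f < maxLabel f :=
  Finset.min'_lt_max'_of_card _ (by rw [card_edge]; norm_num)

theorem minV_ne_maxV (f : M.Face 1) : minV f ≠ maxV f := fun h =>
  (minLabel_lt_maxLabel f).ne (vtx_injective h)

theorem edge_eq (f : M.Face 1) : f.1 = {minLabel f, maxLabel f} := by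
  symm
  apply Finset.eq_of_subset_of_card_le
  · intro x hx
    rcases Finset.mem_insert.1 hx with rfl | hx
    · exact Finset.min'_mem _ _
    · rw [Finset.mem_singleton.1 hx]; exact Finset.max'_mem _ _
  · rw [card_edge, Finset.card_pair (minLabel_lt_maxLabel f).ne]

theorem minV_vtx (v : V) : minV (M.vtx v) = M.vtx v := by
  simp [minV, minLabel, vtx]

theorem maxV_vtx (v : V) : maxV (M.vtx v) = M.vtx v := by
  simp [maxV, vtx]

theorem minV_of_vertex (f : M.Face 0) : minV f = f := by
  obtain ⟨v, rfl⟩ := exists_eq_vtx f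
  exact minV_vtx v

theorem maxV_of_vertex (f : M.Face 0) : maxV f = f := by
  obtain ⟨v, rfl⟩ := exists_eq_vtx f
  exact maxV_vtx v

theorem posBasis_vertex (f : M.Face 0) : posBasis f = [] := by
  obtain ⟨v, rfl⟩ := exists_eq_vtx f
  have hmin : minLabel (M.vtx v) = v := by simp [minLabel, vtx]
  have hempty : (M.vtx v).1.filter (fun x => x ≠ v ∧ {v, x} ∈ M.faces) = ∅ := by
    ext x
    simp only [vtx, Finset.mem_filter, Finset.mem_singleton, Finset.notMem_empty, iff_false]
    tauto
  rw [posBasis, hmin, hempty]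
  simp

theorem posBasis_edge (f : M.Face 1) :
    posBasis f = [M.pos (maxLabel f) - M.pos (minLabel f)] := by
  have hfilter : f.1.filter (fun x => x ≠ minLabel f ∧ {minLabel f, x} ∈ M.faces) =
      {maxLabel f} := by
    have hmem : ({minLabel f, maxLabel f} : Finset V) ∈ M.faces := edge_eq f ▸ f.2.1
    ext x
    rw [edge_eq f]
    simp only [Finset.mem_filter, Finset.mem_insert, Finset.mem_singleton]
    constructor
    · tauto
    · rintro rfl
      exact ⟨Or.inr rfl, (minLabel_lt_maxLabel f).ne', hmem⟩
  rw [posBasis, hfilter]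
  simp

theorem relOrient_one (u w : EuclideanSpace ℝ (Fin d)) :
    relOrient 1 [u] [w] = ((SignType.sign (inner ℝ u w : ℝ) : SignType) : ℤ) := by
  simp [relOrient, Matrix.det_unique]

theorem pos_sub_ne_zero (f : M.Face 1) : M.pos (maxLabel f) - M.pos (minLabel f) ≠ 0 :=
  sub_ne_zero.2 fun h => (minLabel_lt_maxLabel f).ne' (M.pos_injective h)

theorem relOrient_edge_self (f : M.Face 1) : relOrient 1 (posBasis f) (posBasis f) = 1 := by
  rw [posBasis_edge, relOrient_one,
    sign_pos (real_inner_self_pos.2 (pos_sub_ne_zero f))]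
  rfl

theorem pos_sub_mem_dirSpan (f : M.Face 1) :
    M.pos (maxLabel f) - M.pos (minLabel f) ∈ dirSpan M.pos f.1 :=
  vsub_mem_vectorSpan ℝ (Set.mem_image_of_mem _ (Finset.max'_mem _ _))
    (Set.mem_image_of_mem _ (Finset.min'_mem _ _))

theorem dirSpan_vtx (v : V) : dirSpan M.pos (M.vtx v).1 = ⊥ := by
  simp [dirSpan, vtx]

theorem incidence_maxV (f : M.Face 1) : incidence (maxV f) f = 1 := by
  have hsub : (maxV f).1 ⊆ f.1 := by
    rw [maxV_eq]
    exact Finset.singleton_subset_iff.2 (Finset.max'_mem _ _)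
  rw [incidence, if_pos hsub, if_pos]
  -- At the maximal vertex the edge vector itself is an outer normal.
  refine ⟨M.pos (maxLabel f) - M.pos (minLabel f),
    ⟨pos_sub_mem_dirSpan f, pos_sub_ne_zero f, ?_, ?_⟩, ?_⟩
  · intro w hw
    rw [maxV_eq, dirSpan_vtx, Submodule.mem_bot] at hw
    rw [hw, inner_zero_right]
  · intro x hx y hy
    rw [maxV_eq, vtx, Finset.mem_singleton] at hy
    rw [edge_eq f, Finset.mem_insert, Finset.mem_singleton] at hx
    rw [hy]
    rcases hx with rfl | rfl
    · rw [← sub_nonneg, ← inner_sub_right]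
      exact real_inner_self_nonneg
    · exact le_rfl
  · rw [posBasis_vertex, ← relOrient_edge_self f, posBasis_edge]

theorem incidence_minV (f : M.Face 1) : incidence (minV f) f = -1 := by
  have hsub : (minV f).1 ⊆ f.1 := by
    rw [minV_eq]
    exact Finset.singleton_subset_iff.2 (Finset.min'_mem _ _)
  rw [incidence, if_pos hsub, if_neg, if_pos]
  · refine ⟨-(M.pos (maxLabel f) - M.pos (minLabel f)),
      ⟨neg_mem (pos_sub_mem_dirSpan f), neg_ne_zero.2 (pos_sub_ne_zero f), ?_, ?_⟩, ?_⟩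
    · intro w hw
      rw [minV_eq, dirSpan_vtx, Submodule.mem_bot] at hw
      rw [hw, inner_zero_right]
    · intro x hx y hy
      rw [minV_eq, vtx, Finset.mem_singleton] at hy
      rw [edge_eq f, Finset.mem_insert, Finset.mem_singleton] at hx
      rw [hy]
      rcases hx with rfl | rfl
      · exact le_rfl
      · rw [inner_neg_left, inner_neg_left, neg_le_neg_iff, ← sub_nonneg, ← inner_sub_right]
        exact real_inner_self_nonneg
    · rw [posBasis_vertex, posBasis_edge, relOrient_one, inner_neg_left,
        sign_neg (neg_neg_iff_pos.2 (real_inner_self_pos.2 (pos_sub_ne_zero f)))]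
      rfl
  -- The value `+1` is tested first, so it has to be excluded: every outer normal at the minimal
  -- vertex has nonpositive scalar product with the edge vector.
  · rintro ⟨ν, ⟨-, -, -, hle⟩, hor⟩
    rw [posBasis_vertex, posBasis_edge, relOrient_one] at hor
    have h := hle (maxLabel f) (Finset.max'_mem _ _) (minLabel f)
      (by rw [minV_eq]; exact Finset.mem_singleton_self _)
    rw [← sub_nonpos, ← inner_sub_right] at h
    rcases h.lt_or_eq with h | h
    · rw [sign_neg h] at hor
      exact absurd hor (by decide)
    · rw [h, sign_zero] at hor
      exact absurd hor (by decide)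

theorem incidence_eq_zero {e : M.Face 0} {f : M.Face 1} (hmin : e ≠ minV f) (hmax : e ≠ maxV f) :
    incidence e f = 0 := by
  obtain ⟨v, rfl⟩ := exists_eq_vtx e
  rw [incidence, if_neg]
  intro hsub
  have hv : v ∈ f.1 := hsub (Finset.mem_singleton_self v)
  rw [edge_eq f, Finset.mem_insert, Finset.mem_singleton] at hv
  rcases hv with rfl | rfl
  · exact hmin rfl
  · exact hmax rfl

open Classical in
theorem incidence_edge (v : M.Face 0) (f : M.Face 1) :
    incidence v f = (if maxV f = v then 1 else 0) - if minV f = v then 1 else 0 := by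
  by_cases hmax : maxV f = v
  · subst hmax
    rw [incidence_maxV, if_pos rfl, if_neg (minV_ne_maxV f), sub_zero]
  · by_cases hmin : minV f = v
    · subst hmin
      rw [incidence_minV, if_pos rfl, if_neg (minV_ne_maxV f).symm, zero_sub]
    · rw [incidence_eq_zero (Ne.symm hmin) (Ne.symm hmax), if_neg hmax, if_neg hmin, sub_zero]

theorem edge_eq_of_subset {f g : M.Face 1} (h : g.1 ⊆ f.1) : g = f :=
  Subtype.ext (Finset.eq_of_subset_of_card_le h (by rw [card_edge, card_edge]))

theorem splits_edge_vertex_iff {f g : M.Face 1} {h : M.Face 0} :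
    Splits f g h ↔ g = f ∧ maxV f = h := by
  constructor
  · rintro ⟨-, hg, -, -, -, hmax⟩
    exact ⟨edge_eq_of_subset hg, by rw [← hmax, maxV_of_vertex]⟩
  · rintro ⟨rfl, rfl⟩
    refine ⟨rfl, subset_rfl, ?_, rfl, (minV_of_vertex _).symm, maxV_of_vertex _⟩
    exact Finset.singleton_subset_iff.2 (Finset.max'_mem _ _)

theorem splits_vertex_edge_iff {f h : M.Face 1} {g : M.Face 0} :
    Splits f g h ↔ h = f ∧ minV f = g := by
  constructor
  · rintro ⟨-, -, hh, hmin, -, -⟩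
    exact ⟨edge_eq_of_subset hh, by rw [← hmin, minV_of_vertex]⟩
  · rintro ⟨rfl, rfl⟩
    refine ⟨rfl, ?_, subset_rfl, minV_of_vertex _, maxV_of_vertex _, rfl⟩
    exact Finset.singleton_subset_iff.2 (Finset.min'_mem _ _)

theorem tripleSign_edge_vertex (f : M.Face 1) (h : M.Face 0) : tripleSign f f h = 1 := by
  rw [tripleSign, posBasis_vertex, List.append_nil, relOrient_edge_self]

theorem tripleSign_vertex_edge (f : M.Face 1) (g : M.Face 0) : tripleSign f g f = 1 := by
  rw [tripleSign, posBasis_vertex, List.nil_append, relOrient_edge_self]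

open Classical in
theorem cap_edge_edge {p q r : ℕ} (Φ : M.Cochain 1 (Matrix (Fin p) (Fin q) ℂ))
    (Ψ : M.Cochain 1 (Matrix (Fin q) (Fin r) ℂ)) (v : M.Face 0) :
    cap Φ Ψ v = ∑ e, if maxV e = v then Φ e * Ψ e else 0 := by
  refine Finset.sum_congr rfl fun f _ => ?_
  rw [Finset.sum_eq_single f]
  · simp [splits_edge_vertex_iff, tripleSign_edge_vertex]
  · intro g _ hg
    rw [if_neg fun h => hg (splits_edge_vertex_iff.1 h).1]
  · simp

open Classical in
theorem cop_edge_edge {p q r : ℕ} (Φ : M.Cochain 1 (Matrix (Fin p) (Fin q) ℂ))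
    (Ψ : M.Cochain 1 (Matrix (Fin q) (Fin r) ℂ)) (v : M.Face 0) :
    cop Φ Ψ v = ∑ e, if minV e = v then Φ e * Ψ e else 0 := by
  refine Finset.sum_congr rfl fun f _ => ?_
  rw [Finset.sum_eq_single f]
  · simp [splits_vertex_edge_iff, tripleSign_vertex_edge]
  · intro g _ hg
    rw [if_neg fun h => hg (splits_vertex_edge_iff.1 h).1]
  · simp

open Classical in
/-- The covariant divergence at a vertex `v` of a current on edges is the sum over the edges
ending at `v` minus the sum over the edges starting at `v`, parallel transported to `v`. -/
theorem covBoundary_connection_apply {n : ℕ} (U J : M.Cochain 1 (Matrix (Fin n) (Fin n) ℂ))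
    (v : M.Face 0) :
    covBoundary (connection U) J v =
      ∑ e, ((if maxV e = v then (U e)ᴴ * J e else 0) -
        if minV e = v then J e * (U e)ᴴ else 0) := by
  have hsign : (-1 : ℤ) ^ (0 + 1) = -1 := rfl
  rw [covBoundary, hsign, neg_smul, one_smul, ← sub_eq_add_neg, Pi.sub_apply,
    Pi.add_apply]
  simp only [boundary, adj, cap_edge_edge, cop_edge_edge, Matrix.conjTranspose_sum,
    incidence_edge, connection]
  rw [← Finset.sum_add_distrib, ← Finset.sum_sub_distrib]
  refine Finset.sum_congr rfl fun e _ => ?_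
  -- At each end of the edge, the term `∓J e` produced by the `-1` in `U - 1` cancels the boundary
  -- term `±J e`.
  split_ifs <;> simp [sub_mul, mul_sub] <;> abel

end Spacetime

end LatticeGauge

namespace LatticeGauge

/-! ### Tangent spaces of the gauge group. -/

section Tangent

variable {G : Type*} [Group G] {n : ℕ} {ρ : G →* Matrix.unitaryGroup (Fin n) ℂ}

theorem repMat_mul (x y : G) : repMat ρ (x * y) = repMat ρ x * repMat ρ y := by
  simp [repMat]

theorem repMat_one : repMat ρ 1 = 1 := by
  simp [repMat]

theorem repMat_inv (x : G) : repMat ρ x⁻¹ = (repMat ρ x)ᴴ := by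
  simp [repMat, Matrix.star_eq_conjTranspose]

theorem conjTranspose_repMat_mul_repMat (x : G) : (repMat ρ x)ᴴ * repMat ρ x = 1 := by
  rw [← repMat_inv, ← repMat_mul, inv_mul_cancel, repMat_one]

variable {E : Type*} [NormedAddCommGroup E] [NormedSpace ℝ E] [TopologicalSpace G]
  [ChartedSpace E G]

theorem mem_tangentMat {x : G} {X : Matrix (Fin n) (Fin n) ℂ} :
    X ∈ tangentMat E ρ x ↔ ∃ v : E, mfderiv 𝓘(ℝ, E) 𝓘(ℝ, Fin n → Fin n → ℂ)
      (fun (x : G) i j => repMat ρ x i j) x v = X := by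
  constructor
  · rintro ⟨_, ⟨v, rfl⟩, rfl⟩
    exact ⟨v, rfl⟩
  · rintro ⟨v, rfl⟩
    exact ⟨_, ⟨v, rfl⟩, rfl⟩

theorem IsSmoothRep.hasMFDerivAt (hρ : IsSmoothRep E ρ) (x : G) :
    HasMFDerivAt 𝓘(ℝ, E) 𝓘(ℝ, Fin n → Fin n → ℂ) (fun (x : G) i j => repMat ρ x i j) x
      (mfderiv 𝓘(ℝ, E) 𝓘(ℝ, Fin n → Fin n → ℂ) (fun (x : G) i j => repMat ρ x i j) x) :=
  ((hρ x).mdifferentiableAt (by simp)).hasMFDerivAt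

/-- Differentiate the identity `repMat ρ ∘ m = A ∘ repMat ρ` by the chain rule on both sides; the
linear map `A` is its own differential. Left and right translations are the cases of interest. -/
theorem IsSmoothRep.map_mem_tangentMat (hρ : IsSmoothRep E ρ) {m : G → G} {x : G}
    (hm : MDifferentiableAt 𝓘(ℝ, E) 𝓘(ℝ, E) m x)
    (A : Matrix (Fin n) (Fin n) ℂ →ₗ[ℝ] Matrix (Fin n) (Fin n) ℂ)
    (hA : ∀ y, repMat ρ (m y) = A (repMat ρ y)) {X : Matrix (Fin n) (Fin n) ℂ}
    (hX : X ∈ tangentMat E ρ x) : A X ∈ tangentMat E ρ (m x) := by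
  obtain ⟨v, rfl⟩ := mem_tangentMat.1 hX
  let A' : (Fin n → Fin n → ℂ) →L[ℝ] (Fin n → Fin n → ℂ) :=
    LinearMap.toContinuousLinearMap (E := Fin n → Fin n → ℂ) (F' := Fin n → Fin n → ℂ) A
  have h1 := (hρ.hasMFDerivAt (m x)).comp x hm.hasMFDerivAt
  have h2 := (A'.hasFDerivAt (x := fun i j => repMat ρ x i j)).hasMFDerivAt.comp x
    (hρ.hasMFDerivAt x)
  have hfun : (fun (x : G) i j => repMat ρ x i j) ∘ m =
      A' ∘ (fun (x : G) i j => repMat ρ x i j) := funext hA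
  rw [hfun] at h1
  have h := hasMFDerivAt_unique h1 h2
  exact mem_tangentMat.2 ⟨_, DFunLike.congr_fun h v⟩

theorem IsSmoothRep.repMat_mul_mem_tangentMat [LieGroup 𝓘(ℝ, E) ∞ G] (hρ : IsSmoothRep E ρ)
    (u x : G) {X : Matrix (Fin n) (Fin n) ℂ} (hX : X ∈ tangentMat E ρ x) :
    repMat ρ u * X ∈ tangentMat E ρ (u * x) :=
  hρ.map_mem_tangentMat (m := fun y => u * y)
    ((contMDiff_mul_left (I := 𝓘(ℝ, E)) (n := ∞) x).mdifferentiableAt (by simp))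
    (LinearMap.mulLeft ℝ (repMat ρ u)) (fun y => repMat_mul u y) hX

theorem IsSmoothRep.mul_repMat_mem_tangentMat [LieGroup 𝓘(ℝ, E) ∞ G] (hρ : IsSmoothRep E ρ)
    (u x : G) {X : Matrix (Fin n) (Fin n) ℂ} (hX : X ∈ tangentMat E ρ x) :
    X * repMat ρ u ∈ tangentMat E ρ (x * u) :=
  hρ.map_mem_tangentMat (m := fun y => y * u)
    ((contMDiff_mul_right (I := 𝓘(ℝ, E)) (n := ∞) x).mdifferentiableAt (by simp))
    (LinearMap.mulRight ℝ (repMat ρ u)) (fun y => repMat_mul y u) hX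

/-- A differentiable function of a matrix that is constant on the gauge group is stationary at `1`
in the directions of the Lie algebra. -/
theorem IsSmoothRep.hasDerivAt_of_const (hρ : IsSmoothRep E ρ)
    {F : Type*} [NormedAddCommGroup F] [NormedSpace ℝ F] {Φ : Matrix (Fin n) (Fin n) ℂ → F}
    (hΦ : Differentiable ℝ (fun m : Fin n → Fin n → ℂ => Φ (Matrix.of m)))
    {c : F} (hc : ∀ x, Φ (repMat ρ x) = c)
    {X : Matrix (Fin n) (Fin n) ℂ} (hX : X ∈ tangentMat E ρ 1) :
    HasDerivAt (fun t : ℝ => Φ (1 + t • X)) 0 0 := by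
  obtain ⟨v, rfl⟩ := mem_tangentMat.1 hX
  have h1 := (hΦ (fun i j => repMat ρ (1 : G) i j)).hasFDerivAt.hasMFDerivAt.comp (1 : G)
    (hρ.hasMFDerivAt 1)
  -- The composite with the representation is constant on `G`, so the differential of `Φ` vanishes
  -- on the image of the differential of the representation.
  have hfun : ((fun m : Fin n → Fin n → ℂ => Φ (Matrix.of m)) ∘
      (fun (x : G) i j => repMat ρ x i j) : G → F) = fun _ => c := funext hc
  rw [hfun] at h1
  have h := DFunLike.congr_fun (hasMFDerivAt_unique h1 (hasMFDerivAt_const c (1 : G))) v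
  have hline := (hΦ (fun i j => repMat ρ (1 : G) i j)).hasFDerivAt.hasLineDerivAt
    (mfderiv 𝓘(ℝ, E) 𝓘(ℝ, Fin n → Fin n → ℂ) (fun (x : G) i j => repMat ρ x i j) 1 v)
  rw [← repMat_one (ρ := ρ)]
  exact HasDerivAt.congr_deriv hline h

/-- The representation is unitary, so `m ↦ mᴴ * m` is constant on the group; its derivative at `1`
along `X` is `Xᴴ + X`. -/
theorem IsSmoothRep.conjTranspose_eq_neg (hρ : IsSmoothRep E ρ) {X : Matrix (Fin n) (Fin n) ℂ}
    (hX : X ∈ tangentMat E ρ 1) : Xᴴ = -X := by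
  rw [eq_neg_iff_add_eq_zero]
  ext i j
  have hdiff : Differentiable ℝ
      (fun m : Fin n → Fin n → ℂ => ((Matrix.of m)ᴴ * Matrix.of m) i j) := by
    simp only [Matrix.mul_apply, Matrix.conjTranspose_apply, Matrix.of_apply]
    fun_prop
  have h0 := hρ.hasDerivAt_of_const (Φ := fun m => (mᴴ * m) i j) hdiff
    (fun x => by rw [conjTranspose_repMat_mul_repMat]) hX
  have hexp : (fun t : ℝ => ((1 + t • X)ᴴ * (1 + t • X) : Matrix (Fin n) (Fin n) ℂ) i j) =
      fun t : ℝ => (1 : Matrix (Fin n) (Fin n) ℂ) i j +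
        (t • (Xᴴ + X) i j + (t ^ 2) • (Xᴴ * X) i j) := by
    funext t
    have : (1 + t • X)ᴴ * (1 + t • X) = 1 + (t • (Xᴴ + X) + (t ^ 2) • (Xᴴ * X)) := by
      simp only [Matrix.conjTranspose_add, Matrix.conjTranspose_one, Matrix.conjTranspose_smul,
        star_trivial, add_mul, mul_add, one_mul, mul_one, smul_mul_assoc, mul_smul_comm, smul_smul,
        smul_add, pow_two]
      abel
    rw [this]
    rfl
  have h1 := ((((hasDerivAt_id (0 : ℝ)).smul_const ((Xᴴ + X) i j)).add
    ((hasDerivAt_pow 2 (0 : ℝ)).smul_const ((Xᴴ * X) i j)))).const_add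
      ((1 : Matrix (Fin n) (Fin n) ℂ) i j)
  rw [hexp] at h0
  have h := h1.unique h0
  simpa using h

end Tangent

/-! ### A variational criterion for conservation. -/

section Conservation

variable {E : Type*} [NormedAddCommGroup E] [NormedSpace ℝ E]
  {G : Type*} [Group G] [TopologicalSpace G] [ChartedSpace E G] [LieGroup 𝓘(ℝ, E) ∞ G] {n : ℕ}
  {ρ : G →* Matrix.unitaryGroup (Fin n) ℂ}
  {V : Type*} [Fintype V] [LinearOrder V] {d : ℕ} {M : Spacetime V d}

theorem eq_zero_of_re_trace_eq_zero {p q : ℕ} {S : Matrix (Fin p) (Fin q) ℂ}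
    (h : (Matrix.trace (Sᴴ * S)).re = 0) : S = 0 := by
  have hsum : (Matrix.trace (Sᴴ * S)).re = ∑ j, ∑ i, Complex.normSq (S i j) := by
    simp [Matrix.trace, Matrix.mul_apply, Complex.normSq_apply]
  rw [hsum, Finset.sum_eq_zero_iff_of_nonneg fun j _ =>
    Finset.sum_nonneg fun i _ => Complex.normSq_nonneg _] at h
  ext i j
  have hj := h j (Finset.mem_univ j)
  rw [Finset.sum_eq_zero_iff_of_nonneg fun i _ => Complex.normSq_nonneg _] at hj
  exact Complex.normSq_eq_zero.1 (hj i (Finset.mem_univ i))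

open Classical Spacetime in
/-- A current is conserved if it is orthogonal to all infinitesimal gauge transformations located
at a single vertex. -/
theorem IsSmoothRep.isConserved (hρ : IsSmoothRep E ρ) {U : M.Cochain 1 G}
    {j : M.Cochain 1 (Matrix (Fin n) (Fin n) ℂ)}
    (h : ∀ v : M.Face 0, ∀ X ∈ tangentMat E ρ 1,
      ∑ e, ((if maxV e = v then (Matrix.trace ((repMat ρ (U e) * X)ᴴ * j e)).re else 0) -
        if minV e = v then (Matrix.trace ((X * repMat ρ (U e))ᴴ * j e)).re else 0) = 0) :
    IsConserved E ρ U j := by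
  have hmax : ∀ e, (repMat ρ (U e))ᴴ * projTangent E ρ U j e ∈ tangentMat E ρ (1 : G) := by
    intro e
    have := hρ.repMat_mul_mem_tangentMat (U e)⁻¹ (U e) (matProj_spec (tangentMat E ρ (U e)) (j e)).1
    rwa [repMat_inv, inv_mul_cancel] at this
  have hmin : ∀ e, projTangent E ρ U j e * (repMat ρ (U e))ᴴ ∈ tangentMat E ρ (1 : G) := by
    intro e
    have := hρ.mul_repMat_mem_tangentMat (U e)⁻¹ (U e) (matProj_spec (tangentMat E ρ (U e)) (j e)).1
    rwa [repMat_inv, mul_inv_cancel] at this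
  have hproj : ∀ e, ∀ Y ∈ tangentMat E ρ (U e),
      (Matrix.trace (Yᴴ * projTangent E ρ U j e)).re = (Matrix.trace (Yᴴ * j e)).re := by
    intro e Y hY
    have := (matProj_spec (tangentMat E ρ (U e)) (j e)).2 Y hY
    rw [Matrix.mul_sub, Matrix.trace_sub, Complex.sub_re, sub_eq_zero] at this
    exact this.symm
  funext v
  rw [covBoundary_connection_apply]
  -- `S` is the divergence at `v`. It is kept opaque so that only one of the two factors of `⟨S, S⟩`
  -- gets expanded below.
  obtain ⟨S, hS⟩ : ∃ S, S = ∑ e, ((if maxV e = v then (repMat ρ (U e))ᴴ * projTangent E ρ U j e else 0) -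
    if minV e = v then projTangent E ρ U j e * (repMat ρ (U e))ᴴ else 0) := ⟨_, rfl⟩
  have hmem : S ∈ tangentMat E ρ (1 : G) := by
    rw [hS]
    refine Submodule.sum_mem _ fun e _ => Submodule.sub_mem _ ?_ ?_
    · split_ifs
      exacts [hmax e, Submodule.zero_mem _]
    · split_ifs
      exacts [hmin e, Submodule.zero_mem _]
  refine hS.symm.trans (eq_zero_of_re_trace_eq_zero ?_)
  -- The divergence serves as its own test direction `X = S`.
  rw [← h v S hmem]
  nth_rewrite 2 [hS]
  rw [Matrix.mul_sum, Matrix.trace_sum, Complex.re_sum]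
  refine Finset.sum_congr rfl fun e _ => ?_
  have h1 := hproj e _ (by simpa using hρ.repMat_mul_mem_tangentMat (U e) 1 hmem)
  have h2 := hproj e _ (by simpa using hρ.mul_repMat_mem_tangentMat (U e) 1 hmem)
  rw [← h1, ← h2, Matrix.mul_sub, Matrix.trace_sub, Complex.sub_re]
  congr 1
  · split_ifs
    · rw [Matrix.conjTranspose_mul, Matrix.mul_assoc]
    · simp
  · split_ifs
    · rw [Matrix.conjTranspose_mul, Matrix.trace_mul_cycle', Matrix.mul_assoc, Matrix.trace_mul_cycle']
    · simp

end Conservation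

end LatticeGauge

namespace LatticeGauge

open Spacetime

/-! ### Matrix derivatives and the trace pairing. -/

section MatrixDerivative

variable {p q : ℕ}

/-- `matDeriv` records line derivatives only along the matrix units and `i` times them. Real
linearity of `ℓ` recovers all other directions, and the transposed index order together with the
sign of `i` turns the result into `Re Tr`. -/
theorem hasDerivAt_matDeriv {f : Matrix (Fin p) (Fin q) ℂ → ℝ} {z : Matrix (Fin p) (Fin q) ℂ}
    {ℓ : Matrix (Fin p) (Fin q) ℂ →ₗ[ℝ] ℝ}
    (h : ∀ w, HasDerivAt (fun t : ℝ => f (z + t • w)) (ℓ w) 0) (w : Matrix (Fin p) (Fin q) ℂ) :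
    ℓ w = (Matrix.trace (matDeriv f z * w)).re := by
  have hline : ∀ w, lineDeriv ℝ f z w = ℓ w := fun w => (h w).deriv
  have hsingle : ∀ a b, ℓ (Matrix.single a b (w a b)) =
      (w a b).re * ℓ (Matrix.single a b 1) + (w a b).im * ℓ (Matrix.single a b Complex.I) := by
    intro a b
    have hw : (Matrix.single a b (w a b) : Matrix (Fin p) (Fin q) ℂ) =
        (w a b).re • Matrix.single a b 1 + (w a b).im • Matrix.single a b Complex.I := by
      rw [Matrix.smul_single, Matrix.smul_single, ← Matrix.single_add]
      congr 1
      simp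
    rw [hw, map_add, map_smul, map_smul, smul_eq_mul, smul_eq_mul]
  conv_lhs => rw [Matrix.matrix_eq_sum_single w]
  simp only [map_sum, hsingle, Matrix.trace, Matrix.diag_apply, Matrix.mul_apply, matDeriv,
    Matrix.of_apply, hline, Complex.re_sum]
  rw [Finset.sum_comm]
  refine Finset.sum_congr rfl fun b _ => Finset.sum_congr rfl fun a _ => ?_
  simp [Complex.mul_re]
  ring

theorem eq_of_forall_re_trace_mul_eq {A B : Matrix (Fin p) (Fin q) ℂ}
    (h : ∀ w : Matrix (Fin q) (Fin p) ℂ, (Matrix.trace (A * w)).re = (Matrix.trace (B * w)).re) : A = B := by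
  have h0 : (A - B)ᴴ = 0 := by
    apply eq_zero_of_re_trace_eq_zero
    rw [Matrix.conjTranspose_conjTranspose, Matrix.sub_mul, Matrix.trace_sub, Complex.sub_re, h,
      sub_self]
  exact sub_eq_zero.1 (Matrix.conjTranspose_eq_zero.1 h0)

end MatrixDerivative

/-! ### Differentiability of functions of several fields. -/

section Calculus

variable {W : Type*} [NormedAddCommGroup W] [NormedSpace ℝ W]

theorem exists_linear_lineDeriv {Φ : W → ℝ} (hΦ : Differentiable ℝ Φ) (x : W) :
    ∃ ℓ : W →ₗ[ℝ] ℝ, ∀ v, HasDerivAt (fun t : ℝ => Φ (x + t • v)) (ℓ v) 0 :=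
  ⟨fderiv ℝ Φ x, fun v => (hΦ x).hasFDerivAt.hasLineDerivAt v⟩

theorem differentiable_sum_apply {ι : Type*} [Fintype ι] {Ψ : W → ι → ℝ}
    (hΨ : Differentiable ℝ Ψ) : Differentiable ℝ (fun x => ∑ i, Ψ x i) :=
  Differentiable.fun_sum fun i _ => (differentiable_pi.1 hΨ) i

theorem differentiable_apply {ι : Type*} [Fintype ι] {Ψ : W → ι → ℝ}
    (hΨ : Differentiable ℝ Ψ) (i : ι) : Differentiable ℝ (fun x => Ψ x i) :=
  (differentiable_pi.1 hΨ) i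

theorem differentiable_comp_affine {X : Type*} [NormedAddCommGroup X] [NormedSpace ℝ X]
    [FiniteDimensional ℝ X] {Φ : W → ℝ} (hΦ : Differentiable ℝ Φ) (B : X →ₗ[ℝ] W) (x₀ : W)
    (y₀ : X) : Differentiable ℝ (fun y => Φ (x₀ + B (y - y₀))) :=
  hΦ.comp (((LinearMap.toContinuousLinearMap B).differentiable.comp
    (differentiable_id.sub_const y₀)).const_add x₀)

end Calculus

/-! ### The cup product as a function of its second factor. -/

section Cup

variable {V : Type*} [Fintype V] [LinearOrder V] {d : ℕ} {M : Spacetime V d} {k l m p q r n : ℕ}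

theorem cup_add_smul (φ : M.Cochain k (Matrix (Fin p) (Fin q) ℂ))
    (Ψ Θ : M.Cochain l (Matrix (Fin q) (Fin r) ℂ)) (t : ℝ) :
    (cup φ (Ψ + t • Θ) : M.Cochain m _) = cup φ Ψ + t • cup φ Θ := by
  funext f
  simp only [cup, Pi.add_apply, Pi.smul_apply, Finset.smul_sum, ← Finset.sum_add_distrib]
  refine Finset.sum_congr rfl fun g _ => Finset.sum_congr rfl fun h _ => ?_
  split_ifs
  · rw [Matrix.mul_add, Matrix.mul_smul, smul_add, smul_comm t]
  · simp

/-- The covariant coboundary is affine in `U`, so a line in `U` gives a line in `D_A φ`. The slope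
is the origin of the sign `(-1)^(k+1)` in the current. -/
theorem covCoboundary_connection_add_smul (φ : M.Cochain k (Matrix (Fin p) (Fin n) ℂ))
    (U Θ : M.Cochain 1 (Matrix (Fin n) (Fin n) ℂ)) (t : ℝ) :
    covCoboundary (connection (U + t • Θ)) φ =
      covCoboundary (connection U) φ + t • ((-1 : ℤ) ^ (k + 1) • cup φ Θ) := by
  have hconn : connection (U + t • Θ) = connection U + t • Θ := by
    funext e
    simp only [connection, Pi.add_apply]
    abel
  rw [covCoboundary, covCoboundary, hconn, cup_add_smul, smul_add, pow_succ, mul_neg_one, neg_smul,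
    smul_neg, smul_comm t]
  abel

/-- In a splitting the second factor shares its maximal vertex with the whole face. This makes the
dependence on `U(e)` local to `max e`. -/
theorem cup_single_apply_of_ne [DecidableEq (M.Face 1)]
    (φ : M.Cochain k (Matrix (Fin p) (Fin q) ℂ)) (e : M.Face 1)
    (w : Matrix (Fin q) (Fin r) ℂ) (f : M.Face m) (h : maxV f ≠ maxV e) :
    cup φ (Pi.single e w : M.Cochain 1 (Matrix (Fin q) (Fin r) ℂ)) f = 0 := by
  refine Finset.sum_eq_zero fun g _ => Finset.sum_eq_zero fun h' _ => ?_
  split_ifs with hs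
  · have hne : h' ≠ e := by
      rintro rfl
      exact h hs.2.2.2.2.2.symm
    rw [Pi.single_eq_of_ne hne, Matrix.mul_zero, smul_zero]
  · rfl

/-- The cap product with `φ` is dual to the cup product with `φ`. -/
theorem sum_trace_mul_cup_single [DecidableEq (M.Face l)]
    (Φ : M.Cochain m (Matrix (Fin q) (Fin p) ℂ)) (φ : M.Cochain k (Matrix (Fin p) (Fin q) ℂ))
    (e : M.Face l) (w : Matrix (Fin q) (Fin q) ℂ) :
    ∑ f, Matrix.trace (Φ f * cup φ (Pi.single e w : M.Cochain l (Matrix (Fin q) (Fin q) ℂ)) f) =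
      Matrix.trace ((cap Φ φ : M.Cochain l _) e * w) := by
  simp only [cap, cup, Matrix.mul_sum, Matrix.sum_mul, Matrix.trace_sum]
  refine Finset.sum_congr rfl fun f _ => Finset.sum_congr rfl fun g _ => ?_
  rw [Finset.sum_eq_single e]
  · split_ifs
    · rw [Pi.single_eq_same, Matrix.mul_smul, Matrix.smul_mul, Matrix.mul_assoc]
    · simp
  · intro h _ hne
    rw [Pi.single_eq_of_ne hne]
    simp
  · simp

end Cup

/-! ### Derivatives of a local Lagrangian and of its action. -/

section LocalLagrangian

variable {V : Type*} [Fintype V] [LinearOrder V] {d : ℕ} {M : Spacetime V d} {k p n : ℕ}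
  {𝓛 : Lagrangian M k p n} {L : LocalDensity M k p n}

attribute [local instance] Matrix.normedAddCommGroup Matrix.normedSpace

theorem IsLocalLagrangian.hasDerivAt_density (h : IsLocalLagrangian 𝓛 L)
    (φ : M.Cochain k (Matrix (Fin p) (Fin n) ℂ)) (U : M.Cochain 1 (Matrix (Fin n) (Fin n) ℂ))
    (v : M.Face 0) (c : M.FaceAt (k + 1) v → Matrix (Fin p) (Fin n) ℂ) :
    HasDerivAt (fun t : ℝ => L v (fun f => φ f.1)
        ((fun f => covCoboundary (connection U) φ f.1) + t • c))
      (∑ f, (Matrix.trace (derivCov L φ U f.1 * c f)).re) 0 := by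
  classical
  obtain ⟨ℓ, hℓ⟩ := exists_linear_lineDeriv (h.2.1 v)
    (fun f => φ f.1, fun f => covCoboundary (connection U) φ f.1)
  have hD : ∀ c, HasDerivAt (fun t : ℝ => L v (fun f => φ f.1)
      ((fun f => covCoboundary (connection U) φ f.1) + t • c)) (ℓ (0, c)) 0 := by
    intro c
    simpa using hℓ (0, c)
  have hsingle : ∀ (f : M.FaceAt (k + 1) v) (w : Matrix (Fin p) (Fin n) ℂ),
      ℓ (0, Pi.single f w) = (Matrix.trace (derivCov L φ U f.1 * w)).re := by
    rintro ⟨f, rfl⟩ w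
    refine hasDerivAt_matDeriv (ℓ := (ℓ ∘ₗ LinearMap.inr ℝ _ _) ∘ₗ LinearMap.single ℝ
      (fun _ => Matrix (Fin p) (Fin n) ℂ) (⟨f, rfl⟩ : M.FaceAt (k + 1) (maxV f)))
      (fun w => ?_) w
    have := hD (Pi.single ⟨f, rfl⟩ w)
    convert this using 4 with t
    · funext f'
      by_cases hf : f' = ⟨f, rfl⟩
      · subst hf
        simp
      · simp [hf]
    · rfl
  have hc : ℓ (0, c) = ∑ f, (Matrix.trace (derivCov L φ U f.1 * c f)).re := by
    change (ℓ ∘ₗ LinearMap.inr ℝ _ _) c = _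
    conv_lhs => rw [← Finset.univ_sum_single c, map_sum]
    exact Finset.sum_congr rfl fun f _ => hsingle f _
  exact hc ▸ hD c

theorem IsLocalLagrangian.apply_add_smul (h : IsLocalLagrangian 𝓛 L)
    (φ : M.Cochain k (Matrix (Fin p) (Fin n) ℂ)) (U Θ : M.Cochain 1 (Matrix (Fin n) (Fin n) ℂ))
    (v : M.Face 0) (t : ℝ) :
    𝓛 φ (U + t • Θ) v = L v (fun f => φ f.1)
      ((fun f => covCoboundary (connection U) φ f.1) +
        t • fun f => ((-1 : ℤ) ^ (k + 1) • cup φ Θ : M.Cochain (k + 1) _) f.1) := by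
  rw [h.2.2, covCoboundary_connection_add_smul]
  rfl

theorem IsLocalLagrangian.hasDerivAt_derivU [DecidableEq (M.Face 1)] (h : IsLocalLagrangian 𝓛 L)
    (φ : M.Cochain k (Matrix (Fin p) (Fin n) ℂ)) (U : M.Cochain 1 (Matrix (Fin n) (Fin n) ℂ))
    (e : M.Face 1) (w : Matrix (Fin n) (Fin n) ℂ) :
    HasDerivAt (fun t : ℝ => 𝓛 φ (U + t • (Pi.single e w : M.Cochain 1 (Matrix (Fin n) (Fin n) ℂ))) (maxV e))
      (Matrix.trace (derivU 𝓛 φ U e * w)).re 0 := by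
  obtain ⟨ℓ, hℓ⟩ := exists_linear_lineDeriv (differentiable_apply h.1 (maxV e)) (φ, U)
  have hD : ∀ w, HasDerivAt (fun t : ℝ => 𝓛 φ (U + t • (Pi.single e w : M.Cochain 1 (Matrix (Fin n) (Fin n) ℂ))) (maxV e))
      (ℓ (0, Pi.single e w)) 0 := by
    intro w
    simpa using hℓ (0, Pi.single e w)
  have hw : ℓ (0, Pi.single e w) = (Matrix.trace (derivU 𝓛 φ U e * w)).re := by
    refine hasDerivAt_matDeriv (ℓ := (ℓ ∘ₗ LinearMap.inr ℝ _ _) ∘ₗ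
      LinearMap.single ℝ (fun _ => Matrix (Fin n) (Fin n) ℂ) e)
      (fun w => ?_) w
    convert hD w using 4 with t
    · funext e'
      by_cases he : e' = e
      · subst he
        simp
      · simp [he]
    · rfl
  exact hw ▸ hD w

/-- Both sides are compared through `Re Tr` against an arbitrary `w`: the chain rule through `D_A φ`
gives a pairing with `φ ⌣ w`, and duality moves the cup product to a cap product. -/
theorem IsLocalLagrangian.derivU_eq (h : IsLocalLagrangian 𝓛 L)
    (φ : M.Cochain k (Matrix (Fin p) (Fin n) ℂ)) (U : M.Cochain 1 (Matrix (Fin n) (Fin n) ℂ)) :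
    derivU 𝓛 φ U = (-1 : ℤ) ^ (k + 1) • cap (derivCov L φ U) φ := by
  classical
  funext e
  apply eq_of_forall_re_trace_mul_eq
  intro w
  have h1 := h.hasDerivAt_derivU φ U e w
  simp only [h.apply_add_smul] at h1
  rw [h1.unique (h.hasDerivAt_density φ U (maxV e) _), Pi.smul_apply, Matrix.smul_mul,
    Matrix.trace_smul, ← sum_trace_mul_cup_single, Finset.smul_sum, Complex.re_sum]
  simp only [Pi.smul_apply, Matrix.mul_smul, Matrix.trace_smul]
  -- The chain rule sums over faces with maximal vertex `max e`, duality over all faces; the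
  -- additional terms vanish.
  rw [← Finset.sum_subset (Finset.subset_univ (Finset.univ.filter fun f => maxV f = maxV e)),
    Finset.sum_subtype (p := fun f => maxV f = maxV e) _ (by simp)]
  intro f _ hf
  rw [cup_single_apply_of_ne φ e w f (by simpa using hf)]
  simp

theorem IsLocalLagrangian.hasDerivAt_apply_of_ne [DecidableEq (M.Face 1)]
    (h : IsLocalLagrangian 𝓛 L)
    (φ : M.Cochain k (Matrix (Fin p) (Fin n) ℂ)) (U : M.Cochain 1 (Matrix (Fin n) (Fin n) ℂ))
    (e : M.Face 1) (w : Matrix (Fin n) (Fin n) ℂ) {v : M.Face 0} (hv : v ≠ maxV e) :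
    HasDerivAt (fun t : ℝ => 𝓛 φ (U + t • (Pi.single e w : M.Cochain 1 (Matrix (Fin n) (Fin n) ℂ))) v) 0 0 := by
  have hconst : ∀ t : ℝ, 𝓛 φ (U + t • (Pi.single e w : M.Cochain 1 (Matrix (Fin n) (Fin n) ℂ))) v = 𝓛 φ U v := by
    intro t
    rw [h.apply_add_smul, h.2.2]
    congr 1
    funext f
    simp only [Pi.add_apply, Pi.smul_apply]
    rw [cup_single_apply_of_ne φ e w f.1 (by rw [f.2]; exact hv), smul_zero, smul_zero, add_zero]
  simp only [hconst]
  exact hasDerivAt_const _ _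

theorem IsLocalLagrangian.hasDerivAt_action (h : IsLocalLagrangian 𝓛 L)
    {φ : M.Cochain k (Matrix (Fin p) (Fin n) ℂ)} {U : M.Cochain 1 (Matrix (Fin n) (Fin n) ℂ)}
    (hshell : IsOnShell 𝓛 φ U) (Δ : M.Cochain k (Matrix (Fin p) (Fin n) ℂ))
    (Θ : M.Cochain 1 (Matrix (Fin n) (Fin n) ℂ)) :
    HasDerivAt (fun t : ℝ => action 𝓛 (φ + t • Δ) (U + t • Θ))
      (∑ e, (Matrix.trace (derivU 𝓛 φ U e * Θ e)).re) 0 := by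
  classical
  obtain ⟨ℓ, hℓ⟩ := exists_linear_lineDeriv (differentiable_sum_apply h.1) (φ, U)
  -- The on-shell condition removes the matter direction; joint differentiability in `(φ, U)` makes
  -- the two directions add up.
  have hΔ : ℓ (Δ, 0) = 0 := by
    have h1 := hℓ (Δ, 0)
    simp only [Prod.smul_mk, Prod.mk_add_mk, smul_zero, add_zero] at h1
    exact h1.unique (hshell Δ)
  have hsingle : ∀ e w, ℓ (0, Pi.single e w) = (Matrix.trace (derivU 𝓛 φ U e * w)).re := by
    intro e w
    have h1 := hℓ (0, Pi.single e w)
    simp only [Prod.smul_mk, Prod.mk_add_mk, smul_zero, add_zero] at h1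
    have h2 : HasDerivAt (fun t : ℝ => ∑ v, 𝓛 φ (U + t • (Pi.single e w : M.Cochain 1 (Matrix (Fin n) (Fin n) ℂ))) v)
        (∑ v, if v = maxV e then (Matrix.trace (derivU 𝓛 φ U e * w)).re else 0) 0 := by
      -- Only the summand at `max e` depends on `U(e)`.
      refine HasDerivAt.fun_sum fun v _ => ?_
      split_ifs with hv
      · subst hv
        exact h.hasDerivAt_derivU φ U e w
      · exact h.hasDerivAt_apply_of_ne φ U e w hv
    rw [h1.unique h2, Finset.sum_ite_eq' , if_pos (Finset.mem_univ _)]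
  have hval : ℓ (Δ, Θ) = ∑ e, (Matrix.trace (derivU 𝓛 φ U e * Θ e)).re := by
    have hadd : ((Δ, Θ) : M.Cochain k (Matrix (Fin p) (Fin n) ℂ) ×
        M.Cochain 1 (Matrix (Fin n) (Fin n) ℂ)) = (Δ, 0) + (0, Θ) := by simp
    rw [hadd, map_add, hΔ, zero_add]
    change (ℓ ∘ₗ LinearMap.inr ℝ _ _) Θ = _
    conv_lhs => rw [← Finset.univ_sum_single Θ, map_sum]
    exact Finset.sum_congr rfl fun e _ => hsingle e _
  exact hval ▸ hℓ (Δ, Θ)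

end LocalLagrangian

/-! ### Infinitesimal gauge transformations and the Noether identity. -/

section Gauge

variable {V : Type*} [Fintype V] [LinearOrder V] {d : ℕ} {M : Spacetime V d} {k p n : ℕ}
  {𝓛 : Lagrangian M k p n} {L : LocalDensity M k p n}

attribute [local instance] Matrix.normedAddCommGroup Matrix.normedSpace

open Classical in
/-- The infinitesimal gauge transformation of `(φ, U)` located at the vertex `v`. -/
noncomputable def gaugeVariation (φ : M.Cochain k (Matrix (Fin p) (Fin n) ℂ))
    (U : M.Cochain 1 (Matrix (Fin n) (Fin n) ℂ)) (v : M.Face 0) :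
    Matrix (Fin n) (Fin n) ℂ →ₗ[ℝ]
      M.Cochain k (Matrix (Fin p) (Fin n) ℂ) × M.Cochain 1 (Matrix (Fin n) (Fin n) ℂ) where
  toFun X := (fun f => if maxV f = v then φ f * X else 0,
    fun e => (if maxV e = v then U e * X else 0) + if minV e = v then Xᴴ * U e else 0)
  map_add' X Y := by
    ext f : 2
    · simp only [Prod.fst_add, Pi.add_apply]
      split_ifs <;> simp [Matrix.mul_add]
    · simp only [Prod.snd_add, Pi.add_apply]
      split_ifs <;> simp [Matrix.mul_add, Matrix.add_mul] <;> abel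
  map_smul' t X := by
    ext f : 2
    · simp only [Prod.smul_fst, Pi.smul_apply, RingHom.id_apply]
      split_ifs <;> simp
    · simp only [Prod.smul_snd, Pi.smul_apply, RingHom.id_apply]
      split_ifs <;> simp [Matrix.conjTranspose_smul]

variable {G : Type*} [Group G] {ρ : G →* Matrix.unitaryGroup (Fin n) ℂ}

/-- A gauge transformation at one vertex is exactly affine over `ℝ` in the matrix of `x`, not merely
to first order: no edge has both ends at `v`, so no quadratic term appears. -/
theorem gauge_mulSingle [DecidableEq (M.Face 0)] (φ : M.Cochain k (Matrix (Fin p) (Fin n) ℂ))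
    (U : M.Cochain 1 (Matrix (Fin n) (Fin n) ℂ)) (v : M.Face 0) (x : G) :
    (φ, U) + gaugeVariation φ U v (repMat ρ x - 1) =
      (gaugeMatter φ (repMat ρ ∘ Pi.mulSingle v x),
        gaugeConj U (repMat ρ ∘ Pi.mulSingle v x)) := by
  have hval : ∀ v', repMat ρ ((Pi.mulSingle v x : M.Face 0 → G) v') =
      if v' = v then repMat ρ x else 1 := by
    intro v'
    split_ifs with h
    · rw [h, Pi.mulSingle_eq_same]
    · rw [Pi.mulSingle_eq_of_ne h, repMat_one]
  ext f : 2
  · simp only [gaugeVariation, LinearMap.coe_mk, AddHom.coe_mk, Prod.fst_add, Pi.add_apply,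
      gaugeMatter, Function.comp_apply, hval]
    split_ifs <;> simp [Matrix.mul_sub]
  · simp only [gaugeVariation, LinearMap.coe_mk, AddHom.coe_mk, Prod.snd_add, Pi.add_apply,
      gaugeConj, Function.comp_apply, hval]
    have hne := minV_ne_maxV f
    split_ifs with h1 h2 h2
    · exact absurd (h2.trans h1.symm) hne
    · simp [Matrix.mul_sub]
    · simp [Matrix.sub_mul]
    · simp

variable {E : Type*} [NormedAddCommGroup E] [NormedSpace ℝ E] [TopologicalSpace G]
  [ChartedSpace E G]

theorem IsLocalLagrangian.sum_trace_derivU_gaugeVariation (h : IsLocalLagrangian 𝓛 L)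
    (hρ : IsSmoothRep E ρ) (hgauge : IsGaugeInvariant ρ 𝓛)
    {φ : M.Cochain k (Matrix (Fin p) (Fin n) ℂ)} {U : M.Cochain 1 G}
    (hshell : IsOnShell 𝓛 φ (repMat ρ ∘ U)) (v : M.Face 0) {X : Matrix (Fin n) (Fin n) ℂ}
    (hX : X ∈ tangentMat E ρ 1) :
    ∑ e, (Matrix.trace (derivU 𝓛 φ (repMat ρ ∘ U) e *
      (gaugeVariation φ (repMat ρ ∘ U) v X).2 e)).re = 0 := by
  classical
  have hS := differentiable_sum_apply h.1
  -- The affine formula makes sense for every matrix, which extends the action along the orbit to a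
  -- differentiable function on the whole matrix space, constant on the gauge group.
  have hdiff := differentiable_comp_affine (X := Fin n → Fin n → ℂ) hS
    (gaugeVariation φ (repMat ρ ∘ U) v ∘ₗ
      (Matrix.ofLinearEquiv ℝ : (Fin n → Fin n → ℂ) ≃ₗ[ℝ] Matrix (Fin n) (Fin n) ℂ).toLinearMap)
    (φ, repMat ρ ∘ U) ((Matrix.ofLinearEquiv ℝ).symm 1)
  have h0 := hρ.hasDerivAt_of_const
    (Φ := fun m => ∑ w, 𝓛 ((φ, repMat ρ ∘ U) + gaugeVariation φ (repMat ρ ∘ U) v (m - 1)).1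
      ((φ, repMat ρ ∘ U) + gaugeVariation φ (repMat ρ ∘ U) v (m - 1)).2 w) hdiff
    (c := action 𝓛 φ (repMat ρ ∘ U)) (fun x => by rw [gauge_mulSingle, hgauge]; rfl) hX
  simp only [add_sub_cancel_left, map_smul] at h0
  exact (h.hasDerivAt_action hshell _ _).unique h0

variable [LieGroup 𝓘(ℝ, E) ∞ G]

/-- The integer factor `c` covers both forms of the current, with `c = (-1)^(k+1)` and `c = 1`. -/
theorem IsLocalLagrangian.isConserved_smul_derivU (h : IsLocalLagrangian 𝓛 L)
    (hρ : IsSmoothRep E ρ) (hgauge : IsGaugeInvariant ρ 𝓛)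
    {φ : M.Cochain k (Matrix (Fin p) (Fin n) ℂ)} {U : M.Cochain 1 G}
    (hshell : IsOnShell 𝓛 φ (repMat ρ ∘ U)) (c : ℤ) :
    IsConserved E ρ U (c • adj (derivU 𝓛 φ (repMat ρ ∘ U))) := by
  classical
  refine hρ.isConserved fun v X hX => ?_
  have hsum := h.sum_trace_derivU_gaugeVariation hρ hgauge hshell v hX
  have hdual : ∀ A B : Matrix (Fin n) (Fin n) ℂ,
      (Matrix.trace (Aᴴ * (c • Bᴴ))).re = c * (Matrix.trace (B * A)).re := by
    intro A B
    rw [Matrix.mul_smul, ← Matrix.conjTranspose_mul, Matrix.trace_smul,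
      Matrix.trace_conjTranspose]
    simp
  refine Eq.trans ?_ ((congrArg ((c : ℝ) * ·) hsum).trans (mul_zero _))
  rw [Finset.mul_sum]
  refine Finset.sum_congr rfl fun e _ => ?_
  -- Replacing `Xᴴ` by `-X` turns the sum over the two ends of an edge into the difference required
  -- by the criterion.
  simp only [Pi.smul_apply, adj, hdual, gaugeVariation, LinearMap.coe_mk, AddHom.coe_mk,
    hρ.conjTranspose_eq_neg hX, Function.comp_apply]
  split_ifs <;> simp [mul_add, sub_eq_add_neg]

end Gauge

end LatticeGauge

open LatticeGauge LatticeGauge.Spacetime in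
theorem mainTheorem7
    {V : Type*} [Fintype V] [LinearOrder V] {d : ℕ} (M : Spacetime V d)
    {E : Type*} [NormedAddCommGroup E] [NormedSpace ℝ E] [FiniteDimensional ℝ E]
    {G : Type*} [Group G] [TopologicalSpace G] [ChartedSpace E G] [LieGroup 𝓘(ℝ, E) ∞ G]
    {k p n : ℕ} (ρ : G →* Matrix.unitaryGroup (Fin n) ℂ)
    (hρ : IsSmoothRep E ρ)
    (𝓛 : Lagrangian M k p n) (L : LocalDensity M k p n)
    (hlocal : IsLocalLagrangian 𝓛 L) (hgauge : IsGaugeInvariant ρ 𝓛)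
    (φ : M.Cochain k (Matrix (Fin p) (Fin n) ℂ)) (U : M.Cochain 1 G)
    (hshell : IsOnShell 𝓛 φ (repMat ρ ∘ U)) :
    adj (cap (derivCov L φ (repMat ρ ∘ U)) φ : M.Cochain 1 (Matrix (Fin n) (Fin n) ℂ)) =
        (-1 : ℤ) ^ (k + 1) • adj (derivU 𝓛 φ (repMat ρ ∘ U)) ∧
      IsConserved E ρ U (adj (cap (derivCov L φ (repMat ρ ∘ U)) φ)) ∧
      IsConserved E ρ U (adj (derivU 𝓛 φ (repMat ρ ∘ U))) := by
  have hcap : adj (cap (derivCov L φ (repMat ρ ∘ U)) φ : M.Cochain 1 (Matrix (Fin n) (Fin n) ℂ)) =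
      (-1 : ℤ) ^ (k + 1) • adj (derivU 𝓛 φ (repMat ρ ∘ U)) := by
    have hsign : (-1 : ℤ) ^ (k + 1) * (-1 : ℤ) ^ (k + 1) = 1 := by
      rw [← mul_pow, neg_one_mul, neg_neg, one_pow]
    funext e
    simp only [hlocal.derivU_eq, adj, Pi.smul_apply]
    rw [Matrix.conjTranspose_zsmul, smul_smul, hsign, one_smul]
  refine ⟨hcap, ?_, ?_⟩
  · rw [hcap]
    exact hlocal.isConserved_smul_derivU hρ hgauge hshell _
  · simpa using hlocal.isConserved_smul_derivU hρ hgauge hshell 1
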